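/- Let $\mathfrak g$ be a nilpotent real Lie algebra of dimension $2n$. On $\mathfrak g\oplus\mathfrak g^*$ consider the inner product $\langle X+\xi,Y+\eta\rangle=\tfrac12(\xi(Y)+\eta(X))$ and the Courant bracket $[X+\xi,Y+\eta]_c=[X,Y]+\mathcal L_X\eta-\mathcal L_Y\xi$, where $(\mathcal L_X\eta)(Y)=-\eta([X,Y])$. A generalized complex structure on $\mathfrak g$ is a linear endomorphism $\mathcal J$ of $\mathfrak g\oplus\mathfrak g^*$ with $\mathcal J^2=-\mathrm{Id}$, orthogonal for $\langle\cdot,\cdot\rangle$, whose $+i$-eigenspace $L\subset(\mathfrak g\oplus\mathfrak g^*)\otimes\mathbb C$ satisfies $[L,L]_c\subset L$ (for the complex bilinear extension of the bracket). Its type is the complex codimension in $\mathfrak g\otimes\mathbb C$ of the projection of $L$ to $\mathfrak g\otimes\mathbb C$. Let $\mathfrak g^0=\mathfrak g$, $\mathfrak g^i=[\mathfrak g^{i-1},\mathfrak g]$ be the lower central series, let $\mathrm{nil}(\mathfrak g)$ be the least $m$ with $\mathfrak g^m=0$, and let $V_i\subset\mathfrak g^*$ be the annihilator of $\mathfrak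 g^i$. Suppose that $\mathfrak g$ carries a generalized complex structure of type $k>1$ and that there is an integer $j>0$ such that $\dim(V_{i+1}/V_i)=1$ for all $i$ with $j\le i<\mathrm{nil}(\mathfrak g)$. Then $$k\le\begin{cases}2n-\mathrm{nil}(\mathfrak g)+j-2 & \text{if } j>1,\\ 2n-\mathrm{nil}(\mathfrak g) & \text{if } j=1.\end{cases}$$ -/

import Mathlib

open Module TensorProduct

namespace GenComplex

/-- The dimension of `B / A`, for subspaces `A ≤ B` of a vector space. -/
noncomputable def quotientDim {K W : Type*} [Field K] [AddCommGroup W] [Module K W]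
    (A B : Submodule K W) : ℕ :=
  finrank K (B ⧸ A.submoduleOf B)

section

variable (g : Type*) [LieRing g] [LieAlgebra ℝ g]

/-- The real vector space `g ⊕ g*`. -/
abbrev Double : Type _ := g × Dual ℝ g

variable {g}

/-- The Lie derivative of an invariant `1`-form: by Cartan's formula
`L_X η = I_X dη + d(I_X η) = I_X dη`, where `dη (X, Y) = -η [X, Y]` and `I_X η` is a constant
function, so that `d(I_X η) = 0`. -/
def lieDerivative (X : g) (η : Dual ℝ g) : Dual ℝ g :=
  -(η ∘ₗ (LieAlgebra.ad ℝ g X : g →ₗ[ℝ] g))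

@[simp]
theorem lieDerivative_apply (X : g) (η : Dual ℝ g) (Y : g) :
    lieDerivative X η Y = -η ⁅X, Y⁆ := rfl

variable (g)

/-- The Courant bracket on `g ⊕ g*`,
`[X + ξ, Y + η] = [X, Y] + L_X η - L_Y ξ - (1/2) d(I_X η - I_Y ξ)`; the last term is the
differential of an invariant (that is, constant) function, hence zero. -/
noncomputable def courantBracket : Double g →ₗ[ℝ] Double g →ₗ[ℝ] Double g :=
  LinearMap.mk₂ ℝ
    (fun u v => (⁅u.1, v.1⁆, lieDerivative u.1 v.2 - lieDerivative v.1 u.2))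
    (fun u u' v => by ext <;> simp; ring)
    (fun c u v => by ext <;> simp; ring)
    (fun u v v' => by ext <;> simp; ring)
    (fun c u v => by ext <;> simp; ring)

variable {g}

/-- The inner product `⟨X + ξ, Y + η⟩ = (ξ(Y) + η(X)) / 2` on `g ⊕ g*`. -/
noncomputable def pairing (u v : Double g) : ℝ := (1 / 2) * (u.2 v.1 + v.2 u.1)

/-- The eigenspace for the eigenvalue `+i` of the complexification of an endomorphism of
`g ⊕ g*`, a complex subspace of `(g ⊕ g*) ⊗ ℂ`. -/
noncomputable def plusISpace (J : Double g →ₗ[ℝ] Double g) : Submodule ℂ (ℂ ⊗[ℝ] Double g) :=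
  End.eigenspace (J.baseChange ℂ) Complex.I

variable (g)

/-- A generalized complex structure on the real Lie algebra `g`: an endomorphism of `g ⊕ g*`
with square `-1`, orthogonal for the pairing, whose `+i`-eigenspace is closed under the
(complex bilinear extension of the) Courant bracket. -/
structure GeneralizedComplexStructure where
  /-- The underlying endomorphism of `g ⊕ g*`. -/
  J : Double g →ₗ[ℝ] Double g
  sq_eq_neg : ∀ u, J (J u) = -u
  orthogonal : ∀ u v, pairing (J u) (J v) = pairing u v
  involutive : ∀ u ∈ plusISpace J, ∀ v ∈ plusISpace J,
    LinearMap.BilinMap.baseChange ℂ (courantBracket g) u v ∈ plusISpace J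

variable {g}

/-- The type of a generalized complex structure: the complex codimension, in `g ⊗ ℂ`, of the
projection of the `+i`-eigenspace to `g ⊗ ℂ`. -/
noncomputable def GeneralizedComplexStructure.type (S : GeneralizedComplexStructure g) : ℕ :=
  finrank ℂ ((ℂ ⊗[ℝ] g) ⧸
    (plusISpace S.J).map ((LinearMap.fst ℝ g (Dual ℝ g)).baseChange ℂ))

variable (g)

/-- `V_i`: the annihilator in `g*` of the `i`-th term of the lower central series
`g^0 = g`, `g^i = [g^(i-1), g]`. -/
def lcsAnnihilator (i : ℕ) : Submodule ℝ (Dual ℝ g) :=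
  (LieModule.lowerCentralSeries ℝ g g i).toSubmodule.dualAnnihilator

/-- The dimension of `V_(i+1) / V_i`. -/
noncomputable def lcsStep (i : ℕ) : ℕ :=
  quotientDim (lcsAnnihilator g i) (lcsAnnihilator g (i + 1))

/-- The nilpotency index `nil(g)`: the least `m` with `g^m = 0`. -/
noncomputable def nilIndex : ℕ := LieModule.nilpotencyLength g g

end

end GenComplex

/-! Let E be the projection of L to the complexification of g. It is a subalgebra with E + conj E
everything, and k = 2n - dim E, so dim E must be bounded below. Put N = 2n, m = nil(g), d_i = dim
g^i and e_i = dim (E + g^i), so e_m = dim E.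

For i ≥ j each quotient g^i/g^(i+1) is a line, so e_i drops by at most 1 per step; by
`supLcs_succ_eq_of_eq`, once it stops dropping it never drops again. Conjugation gives N + d_i ≤ 2
e_i, and at the last drop this yields e_m ≥ m - j + (N - e_j). By `supLcs_succ_eq_top`, E + g^i
cannot first become proper after i = 1. Hence if e drops at j, then N - e_j ≥ 1, and N - e_j ≥ 2
when j > 1. If e does not drop at j, the conjugation bound with k > 1 suffices. -/

namespace GenComplex

open LieModule

/-! ### Subalgebras and the lower central series -/

section Subalgebra

variable {K M : Type*} [Field K] [LieRing M] [LieAlgebra K M]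

theorem lie_mem_lowerCentralSeries_succ {i : ℕ} (x : M) {y : M}
    (hy : y ∈ lowerCentralSeries K M M i) : ⁅x, y⁆ ∈ lowerCentralSeries K M M (i + 1) := by
  rw [lowerCentralSeries_succ]
  exact LieSubmodule.lie_mem_lie (LieSubmodule.mem_top x) hy

theorem lie_mem_lowerCentralSeries_succ' {i : ℕ} {x : M} (y : M)
    (hx : x ∈ lowerCentralSeries K M M i) : ⁅x, y⁆ ∈ lowerCentralSeries K M M (i + 1) := by
  rw [← lie_skew]
  exact neg_mem (lie_mem_lowerCentralSeries_succ y hx)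

theorem lowerCentralSeries_succ_le {i : ℕ} {N : Submodule K M}
    (h : ∀ x : M, ∀ y ∈ lowerCentralSeries K M M i, ⁅x, y⁆ ∈ N) :
    (lowerCentralSeries K M M (i + 1)).toSubmodule ≤ N := by
  rw [lowerCentralSeries_succ, LieSubmodule.lieIdeal_oper_eq_linear_span', Submodule.span_le]
  rintro _ ⟨x, -, y, hy, rfl⟩
  exact h x y hy

theorem lowerCentralSeries_toSubmodule_antitone :
    Antitone fun i => (lowerCentralSeries K M M i).toSubmodule := fun _ _ h _ hx =>
  antitone_lowerCentralSeries K M M h hx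

/-- The sum of a subspace `E` of a Lie algebra and the `i`-th term of the lower central series. -/
def supLcs (E : Submodule K M) (i : ℕ) : Submodule K M :=
  E ⊔ (lowerCentralSeries K M M i).toSubmodule

theorem supLcs_antitone (E : Submodule K M) : Antitone (supLcs E) := fun _ _ h =>
  sup_le_sup_left (lowerCentralSeries_toSubmodule_antitone h) E

/-- Expanding brackets in g = E + g^i gives [g, g] ⊆ E + g^(i+1), and g^i ⊆ [g, g] because i ≥ 1. -/
theorem supLcs_succ_eq_top {E : Submodule K M} (hE : ∀ x ∈ E, ∀ y ∈ E, ⁅x, y⁆ ∈ E) {i : ℕ}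
    (hi : 1 ≤ i) (h : supLcs E i = ⊤) : supLcs E (i + 1) = ⊤ := by
  have key : (lowerCentralSeries K M M (0 + 1)).toSubmodule ≤ supLcs E (i + 1) := by
    refine lowerCentralSeries_succ_le fun x y _ => ?_
    have hx : x ∈ supLcs E i := h ▸ Submodule.mem_top
    have hy : y ∈ supLcs E i := h ▸ Submodule.mem_top
    obtain ⟨a, ha, b, hb, rfl⟩ := Submodule.mem_sup.1 hx
    obtain ⟨c, hc, d, hd, rfl⟩ := Submodule.mem_sup.1 hy
    rw [lie_add, add_lie, add_assoc]
    exact Submodule.add_mem_sup (hE a ha c hc) (add_mem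
      (lie_mem_lowerCentralSeries_succ' c hb) (lie_mem_lowerCentralSeries_succ (a + b) hd))
  rw [eq_top_iff, ← h]
  exact sup_le le_sup_left ((lowerCentralSeries_toSubmodule_antitone hi).trans key)

variable [FiniteDimensional K M]

theorem finrank_supLcs_add_le (E : Submodule K M) (i : ℕ) :
    finrank K (supLcs E i) + finrank K (lowerCentralSeries K M M (i + 1)).toSubmodule ≤
      finrank K (supLcs E (i + 1)) + finrank K (lowerCentralSeries K M M i).toSubmodule := by
  have h1 := Submodule.finrank_sup_add_finrank_inf_eq E (lowerCentralSeries K M M i).toSubmodule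
  have h2 := Submodule.finrank_sup_add_finrank_inf_eq E
    (lowerCentralSeries K M M (i + 1)).toSubmodule
  have h3 : finrank K (E ⊓ (lowerCentralSeries K M M (i + 1)).toSubmodule : Submodule K M) ≤
      finrank K (E ⊓ (lowerCentralSeries K M M i).toSubmodule : Submodule K M) :=
    Submodule.finrank_mono (inf_le_inf_left E (antitone_lowerCentralSeries K M M i.le_succ))
  unfold supLcs
  omega

/-- If E ∩ g^(i+1) is not inside g^(i+2), it spans the quotient, which has dimension at most 1.
Otherwise [E, g^i] ⊆ g^(i+2); applying σ and using E + σE = g, this forces g^(i+1) ⊆ g^(i+2). -/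
theorem supLcs_succ_eq_of_eq {E : Submodule K M} (hE : ∀ x ∈ E, ∀ y ∈ E, ⁅x, y⁆ ∈ E) (σ : M → M)
    (hσσ : ∀ x, σ (σ x) = x) (hσlie : ∀ x y, σ ⁅x, y⁆ = ⁅σ x, σ y⁆)
    (hσG : ∀ i, ∀ x ∈ lowerCentralSeries K M M i, σ x ∈ lowerCentralSeries K M M i)
    (hEσ : ∀ x, ∃ a ∈ E, ∃ b ∈ E, x = a + σ b) {i : ℕ}
    (hdim : finrank K (lowerCentralSeries K M M (i + 1)).toSubmodule ≤
      finrank K (lowerCentralSeries K M M (i + 2)).toSubmodule + 1)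
    (h : supLcs E i = supLcs E (i + 1)) : supLcs E (i + 1) = supLcs E (i + 2) := by
  refine le_antisymm (sup_le le_sup_left ?_) (supLcs_antitone E (i + 1).le_succ)
  by_contra hnot
  have hle : (lowerCentralSeries K M M (i + 2)).toSubmodule ≤
      (lowerCentralSeries K M M (i + 1)).toSubmodule :=
    antitone_lowerCentralSeries K M M (i + 1).le_succ
  have hinf : E ⊓ (lowerCentralSeries K M M (i + 1)).toSubmodule ≤
      (lowerCentralSeries K M M (i + 2)).toSubmodule := by
    by_contra hinf
    have hlt := Submodule.finrank_lt_finrank_of_lt (right_lt_sup.2 hinf)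
    have heq := Submodule.eq_of_le_of_finrank_le
      (sup_le (inf_le_right (a := E)) hle) (by omega)
    rw [← heq] at hnot
    exact hnot (sup_le_sup_right inf_le_left _)
  have hlieE : ∀ e ∈ E, ∀ y ∈ lowerCentralSeries K M M i,
      ⁅e, y⁆ ∈ lowerCentralSeries K M M (i + 2) := by
    intro e he y hy
    have hy' : y ∈ supLcs E (i + 1) := h ▸ Submodule.mem_sup_right hy
    obtain ⟨a, ha, z, hz, rfl⟩ := Submodule.mem_sup.1 hy'
    have ha' : a ∈ lowerCentralSeries K M M i := by
      simpa using sub_mem hy (antitone_lowerCentralSeries K M M i.le_succ hz)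
    rw [lie_add]
    exact add_mem (hinf ⟨hE e he a ha, lie_mem_lowerCentralSeries_succ e ha'⟩)
      (lie_mem_lowerCentralSeries_succ e hz)
  refine hnot ((lowerCentralSeries_succ_le fun x y hy => ?_).trans le_sup_right)
  obtain ⟨a, ha, b, hb, rfl⟩ := hEσ x
  rw [add_lie]
  refine add_mem (hlieE a ha y hy) ?_
  have := hσG _ _ (hlieE b hb _ (hσG _ _ hy))
  rwa [hσlie, hσσ] at this

end Subalgebra

/-- F and σF have equal dimension, span everything, and both contain N. -/
theorem finrank_add_finrank_le_of_conj {M : Type*} [AddCommGroup M] [Module ℂ M]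
    [FiniteDimensional ℂ M] (σ : M ≃ₛₗ[starRingEnd ℂ] M) {F N : Submodule ℂ M} (hN : N ≤ F)
    (hσN : ∀ x ∈ N, σ.symm x ∈ N) (hF : ∀ x, ∃ a ∈ F, ∃ b ∈ F, x = a + σ b) :
    finrank ℂ M + finrank ℂ N ≤ 2 * finrank ℂ F := by
  have h1 : finrank ℂ (F.map σ.toLinearMap) = finrank ℂ F :=
    (congrArg Cardinal.toNat (rank_eq_of_equiv_equiv (starRingEnd ℂ)
      (σ.submoduleMap F).toAddEquiv (starRingAut (R := ℂ)).bijective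
      fun r m => (σ.submoduleMap F).map_smulₛₗ r m)).symm
  have h2 : F ⊔ F.map σ.toLinearMap = ⊤ := by
    rw [eq_top_iff]
    intro x _
    obtain ⟨a, ha, b, hb, rfl⟩ := hF x
    exact Submodule.add_mem_sup ha (Submodule.mem_map_of_mem hb)
  have h3 : N ≤ F ⊓ F.map σ.toLinearMap :=
    le_inf hN fun x hx => ⟨σ.symm x, hN (hσN x hx), σ.apply_symm_apply x⟩
  have h4 := Submodule.finrank_sup_add_finrank_inf_eq F (F.map σ.toLinearMap)
  have h5 := Submodule.finrank_mono h3
  rw [h2, finrank_top] at h4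
  omega

/-! ### Complexification and conjugation -/

section Complexification

/-- The extension of scalars, with the module structure on `A` that comes from the algebra. -/
abbrev ExtendedScalars (R A W : Type*) [CommRing R] [CommRing A] [Algebra R A] [AddCommGroup W]
    [Module R W] : Type _ := A ⊗[R] W

/-- The complexification of a real vector space. -/
abbrev Complexification (W : Type*) [AddCommGroup W] [Module ℝ W] : Type _ :=
  ExtendedScalars ℝ ℂ W

/-- Complex conjugation on the complexification of a real vector space. -/
noncomputable def conjTensor (W : Type*) [AddCommGroup W] [Module ℝ W] :
    Complexification W ≃ₛₗ[starRingEnd ℂ] Complexification W :=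
  { TensorProduct.congr Complex.conjAe.toLinearEquiv (LinearEquiv.refl ℝ W) with
    map_smul' := fun c x => by
      induction x using TensorProduct.induction_on with
      | zero => simp
      | tmul a w => simp [TensorProduct.smul_tmul']
      | add x y hx hy => simp_all [smul_add] }

@[simp]
theorem conjTensor_tmul {W : Type*} [AddCommGroup W] [Module ℝ W] (c : ℂ) (w : W) :
    conjTensor W (c ⊗ₜ w) = (starRingEnd ℂ c) ⊗ₜ w := rfl

theorem conjTensor_conjTensor {W : Type*} [AddCommGroup W] [Module ℝ W] (x : Complexification W) :
    conjTensor W (conjTensor W x) = x := by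
  induction x using TensorProduct.induction_on with
  | zero => simp
  | tmul a w => simp
  | add x y hx hy => simp [hx, hy]

theorem conjTensor_symm_apply {W : Type*} [AddCommGroup W] [Module ℝ W] (x : Complexification W) :
    (conjTensor W).symm x = conjTensor W x := by
  rw [LinearEquiv.symm_apply_eq, conjTensor_conjTensor]

theorem conjTensor_mem_baseChange {W : Type*} [AddCommGroup W] [Module ℝ W] {N : Submodule ℝ W}
    {x : Complexification W} (hx : x ∈ N.baseChange ℂ) : conjTensor W x ∈ N.baseChange ℂ := by
  rw [Submodule.baseChange_eq_span] at hx
  induction hx using Submodule.span_induction with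
  | mem x hx =>
    obtain ⟨w, hw, rfl⟩ := hx
    simpa using Submodule.tmul_mem_baseChange_of_mem 1 hw
  | zero => simp
  | add x y _ _ hx hy => rw [map_add]; exact add_mem hx hy
  | smul c x _ hx => rw [LinearEquiv.map_smulₛₗ]; exact Submodule.smul_mem _ _ hx

theorem finrank_submodule_baseChange {W : Type*} [AddCommGroup W] [Module ℝ W]
    (N : Submodule ℝ W) : finrank ℂ (N.baseChange ℂ) = finrank ℝ N := by
  rw [← (Submodule.toBaseChange.toLinearEquiv ℂ N).finrank_eq, finrank_baseChange]

variable {g : Type*} [LieRing g] [LieAlgebra ℝ g]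

theorem conjTensor_lie (x y : Complexification g) :
    conjTensor g ⁅x, y⁆ = ⁅conjTensor g x, conjTensor g y⁆ := by
  induction x using TensorProduct.induction_on with
  | zero => simp
  | add x x' hx hx' => simp [hx, hx']
  | tmul a u =>
    induction y using TensorProduct.induction_on with
    | zero => simp
    | add y y' hy hy' => simp only [map_add, lie_add, hy, hy']
    | tmul b v => simp

theorem lowerCentralSeries_complexification (i : ℕ) :
    lowerCentralSeries ℂ (Complexification g) (Complexification g) i =
      (lowerCentralSeries ℝ g g i).baseChange ℂ := by
  induction i with
  | zero => simp
  | succ i ih =>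
    rw [lowerCentralSeries_succ, lowerCentralSeries_succ, ih, LieSubmodule.lie_baseChange,
      LieSubmodule.baseChange_top]

theorem conjTensor_mem_lowerCentralSeries {i : ℕ} {x : Complexification g}
    (hx : x ∈ lowerCentralSeries ℂ (Complexification g) (Complexification g) i) :
    conjTensor g x ∈ lowerCentralSeries ℂ (Complexification g) (Complexification g) i := by
  rw [lowerCentralSeries_complexification] at hx ⊢
  exact conjTensor_mem_baseChange hx

theorem finrank_lowerCentralSeries_complexification (i : ℕ) :
    finrank ℂ (lowerCentralSeries ℂ (Complexification g) (Complexification g) i).toSubmodule =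
      finrank ℝ (lowerCentralSeries ℝ g g i).toSubmodule := by
  rw [lowerCentralSeries_complexification, LieSubmodule.coe_baseChange,
    finrank_submodule_baseChange]

theorem lowerCentralSeries_nilIndex [LieRing.IsNilpotent g] :
    lowerCentralSeries ℝ g g (nilIndex g) = ⊥ := by
  -- The nilpotency length is an infimum over the series taken with ℤ coefficients, whose terms have
  -- the same underlying sets.
  have h := Nat.sInf_mem (s := {k | lowerCentralSeries ℤ g g k = ⊥})
    ((LieModule.isNilpotent_iff ℤ g g).1 inferInstance)
  rw [eq_bot_iff]
  intro x hx
  have h' : x ∈ lowerCentralSeries ℤ g g (nilIndex g) := by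
    rw [← SetLike.mem_coe, ← coe_lowerCentralSeries_eq_int ℝ g g]
    exact hx
  have h2 : lowerCentralSeries ℤ g g (nilIndex g) = ⊥ := h
  rw [h2] at h'
  simpa using h'

theorem finrank_lowerCentralSeries_eq_add_lcsStep [FiniteDimensional ℝ g] (i : ℕ) :
    finrank ℝ (lowerCentralSeries ℝ g g i).toSubmodule =
      finrank ℝ (lowerCentralSeries ℝ g g (i + 1)).toSubmodule + lcsStep g i := by
  have hle : lcsAnnihilator g i ≤ lcsAnnihilator g (i + 1) :=
    Submodule.dualAnnihilator_anti (antitone_lowerCentralSeries ℝ g g i.le_succ)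
  have h1 := Submodule.finrank_quotient_add_finrank (R := ℝ) (M := lcsAnnihilator g (i + 1))
    ((lcsAnnihilator g i).submoduleOf (lcsAnnihilator g (i + 1)))
  rw [(Submodule.submoduleOfEquivOfLe hle).finrank_eq] at h1
  have h2 := Subspace.finrank_add_finrank_dualAnnihilator_eq
    (lowerCentralSeries ℝ g g i).toSubmodule
  have h3 := Subspace.finrank_add_finrank_dualAnnihilator_eq
    (lowerCentralSeries ℝ g g (i + 1)).toSubmodule
  unfold lcsStep quotientDim
  unfold lcsAnnihilator at *
  omega

end Complexification

/-! ### The projection of the +i-eigenspace -/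

namespace GeneralizedComplexStructure

variable {g : Type*} [LieRing g] [LieAlgebra ℝ g] (S : GeneralizedComplexStructure g)

/-- The projection to `g ⊗ ℂ` of the `+i`-eigenspace. -/
noncomputable def projection : Submodule ℂ (Complexification g) :=
  (plusISpace S.J).map ((LinearMap.fst ℝ g (Dual ℝ g)).baseChange ℂ)

theorem fst_baseChange_courantBracket (u v : Complexification (Double g)) :
    (LinearMap.fst ℝ g (Dual ℝ g)).baseChange ℂ
        (LinearMap.BilinMap.baseChange ℂ (courantBracket g) u v) =
      ⁅(LinearMap.fst ℝ g (Dual ℝ g)).baseChange ℂ u,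
        (LinearMap.fst ℝ g (Dual ℝ g)).baseChange ℂ v⁆ := by
  induction u using TensorProduct.induction_on with
  | zero => simp
  | add u u' hu hu' => simp only [map_add, LinearMap.add_apply, add_lie, hu, hu']
  | tmul a x =>
    induction v using TensorProduct.induction_on with
    | zero => simp
    | add v v' hv hv' => simp only [map_add, lie_add, hv, hv']
    | tmul b y => simp [LinearMap.BilinMap.baseChange_tmul, courantBracket]

theorem lie_mem_projection {x y : Complexification g} (hx : x ∈ S.projection)
    (hy : y ∈ S.projection) :
    ⁅x, y⁆ ∈ S.projection := by
  obtain ⟨u, hu, rfl⟩ := hx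
  obtain ⟨v, hv, rfl⟩ := hy
  exact ⟨_, S.involutive u hu v hv, fst_baseChange_courantBracket u v⟩

/-- 1 - iJ maps into the +i-eigenspace; apply it to x + 0. -/
theorem tmul_sub_mem_projection (x : g) :
    (1 : ℂ) ⊗ₜ[ℝ] x - Complex.I ⊗ₜ[ℝ] (S.J (x, 0)).1 ∈ S.projection := by
  refine ⟨1 ⊗ₜ (x, 0) - Complex.I ⊗ₜ S.J (x, 0), ?_, by simp⟩
  refine End.mem_eigenspace_iff.2 ?_
  simp only [map_sub, LinearMap.baseChange_tmul, S.sq_eq_neg, TensorProduct.tmul_neg, smul_sub,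
    TensorProduct.smul_tmul', smul_eq_mul, mul_one, Complex.I_mul_I, TensorProduct.neg_tmul]
  abel

theorem exists_eq_add_conj (z : Complexification g) :
    ∃ a ∈ S.projection, ∃ b ∈ S.projection, z = a + conjTensor g b := by
  induction z using TensorProduct.induction_on with
  | zero => exact ⟨0, zero_mem _, 0, zero_mem _, by simp⟩
  | add z w hz hw =>
    obtain ⟨a, ha, b, hb, rfl⟩ := hz
    obtain ⟨c, hc, d, hd, rfl⟩ := hw
    exact ⟨a + c, add_mem ha hc, b + d, add_mem hb hd, by rw [map_add]; abel⟩
  | tmul c x =>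
    have h := S.tmul_sub_mem_projection x
    -- x is half the sum of x - i(Jx)₁ and its conjugate.
    refine ⟨(c / 2) • _, Submodule.smul_mem _ _ h,
      (starRingEnd ℂ (c / 2)) • _, Submodule.smul_mem _ _ h, ?_⟩
    rw [LinearEquiv.map_smulₛₗ]
    simp only [map_sub, conjTensor_tmul, smul_sub, TensorProduct.smul_tmul', Complex.conj_conj,
      map_one, Complex.conj_I, smul_eq_mul, mul_one, TensorProduct.neg_tmul]
    rw [smul_neg, TensorProduct.smul_tmul', smul_eq_mul, sub_neg_eq_add, sub_add_add_cancel,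
      ← TensorProduct.add_tmul, add_halves]

theorem type_add_finrank_projection [FiniteDimensional ℝ g] :
    S.type + finrank ℂ S.projection = finrank ℝ g := by
  rw [← finrank_baseChange (R := ℂ) (S := ℝ) (M' := g)]
  exact Submodule.finrank_quotient_add_finrank _

end GeneralizedComplexStructure

/-- The dimension count: `e i` and `d i` play the roles of the dimensions of `E + g^i` and of
`g^i`. -/
theorem le_dim_of_filtration {N m j : ℕ} {e d : ℕ → ℕ} (hj : 0 < j) (hdm : d m = 0)
    (hd : ∀ i, j ≤ i → i < m → d i = d (i + 1) + 1) (heN : ∀ i, e i ≤ N)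
    (he : ∀ i, e (i + 1) ≤ e i) (hed : ∀ i, e i + d (i + 1) ≤ e (i + 1) + d i)
    (hconj : ∀ i, N + d i ≤ 2 * e i)
    (htop : ∀ i, 1 ≤ i → e i = N → e (i + 1) = N)
    (hstat : ∀ i, d (i + 1) ≤ d (i + 2) + 1 → e i = e (i + 1) → e (i + 1) = e (i + 2))
    (hk : e m + 1 < N) : (1 < j → m + 2 ≤ e m + j) ∧ (j = 1 → m ≤ e m) := by
  have hm := hconj m
  rcases lt_or_ge m j with hmj | hjm
  · constructor <;> intros <;> omega
  have hdi : ∀ i, j ≤ i → i ≤ m → d i + i = m := by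
    intro i hi him
    induction him using Nat.decreasingInduction with
    | self => omega
    | of_succ i him ih =>
      have := hd i hi him
      have := ih (by omega)
      omega
  have hcj := hconj j
  have hdj := hdi j le_rfl hjm
  by_cases hjj : j = m ∨ e j = e (j + 1)
  · have hconst : ∀ i, j ≤ i → i ≤ m → e i = e j ∧ (i < m → e (i + 1) = e i) := by
      intro i hi
      induction i, hi using Nat.le_induction with
      | base => exact fun _ => ⟨rfl, fun _ => by omega⟩
      | succ i hi ih =>
        intro him
        obtain ⟨h1, h2⟩ := ih (by omega)
        have h3 := h2 (by omega)
        refine ⟨h3.trans h1, fun h4 => (hstat i ?_ h3.symm).symm⟩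
        have : d (i + 1) = d (i + 2) + 1 := hd (i + 1) (by omega) h4
        omega
    -- Now N + m - j ≤ 2 e_m, while e_m ≤ N - 2.
    have := (hconst m hjm le_rfl).1
    constructor <;> intros <;> omega
  obtain ⟨hne, hjump⟩ := not_or.1 hjj
  have hjN : e j < N := by
    refine lt_of_le_of_ne (heN j) fun h => hjump ?_
    rw [h, htop j hj h]
  have hjN2 : 1 < j → e j + 2 ≤ N := by
    intro h1j
    by_contra hlt
    obtain ⟨i, rfl⟩ : ∃ i, j = i + 1 := ⟨j - 1, by omega⟩
    -- No drop at j - 1 would exclude the drop at j; so e_j = N - 1 would force e_(j-1) = N, against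
    -- `htop`, as j - 1 ≥ 1.
    have hi : e i ≠ e (i + 1) := fun h =>
      hjump (hstat i (hd (i + 1) le_rfl (by omega)).le h)
    have := he i
    have := heN i
    have := htop i (by omega) (by omega)
    omega
  -- While e keeps dropping, e_i + i = e_j + j turns `hconj` into the bound; once e is stationary,
  -- the bound persists.
  have hind : ∀ i, j + 1 ≤ i → i ≤ m →
      N + m ≤ e i + e j + j ∧ (e i + i = e j + j ∨ e i = e (i - 1)) := by
    intro i hi
    induction i, hi using Nat.le_induction with
    | base =>
      intro him
      have := he j
      have := hed j
      have := hconj (j + 1)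
      have := hdi (j + 1) (by omega) him
      omega
    | succ i hi ih =>
      intro him
      obtain ⟨h1, h2⟩ := ih (by omega)
      have := he i
      have := hed i
      have := hconj (i + 1)
      have := hdi (i + 1) (by omega) him
      have := hdi i (by omega) (by omega)
      have hs : e (i - 1) = e i → e i = e (i + 1) := by
        have := hstat (i - 1)
        rw [show i - 1 + 1 = i by omega, show i - 1 + 2 = i + 1 by omega] at this
        exact this (by omega)
      rw [Nat.add_sub_cancel]
      omega
  have := (hind m (by omega) le_rfl).1
  constructor <;> intros <;> omega

end GenComplex

theorem mainTheorem2 {g : Type*} [LieRing g] [LieAlgebra ℝ g] [FiniteDimensional ℝ g]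
    [LieRing.IsNilpotent g] (n : ℕ) (hn : Module.finrank ℝ g = 2 * n)
    (S : GenComplex.GeneralizedComplexStructure g) (k : ℕ) (hS : S.type = k) (hk : 1 < k)
    (j : ℕ) (hj : 0 < j)
    (hV : ∀ i, j ≤ i → i < GenComplex.nilIndex g → GenComplex.lcsStep g i = 1) :
    (1 < j → (k : ℤ) ≤ 2 * n - GenComplex.nilIndex g + j - 2) ∧
      (j = 1 → (k : ℤ) ≤ 2 * n - GenComplex.nilIndex g) := by
  have hG := S.exists_eq_add_conj
  have hE : ∀ x ∈ S.projection, ∀ y ∈ S.projection, ⁅x, y⁆ ∈ S.projection :=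
    fun x hx y hy => S.lie_mem_projection hx hy
  have hM : Module.finrank ℂ (GenComplex.Complexification g) = 2 * n := by
    rw [Module.finrank_baseChange, hn]
  have hbot : (LieModule.lowerCentralSeries ℂ (GenComplex.Complexification g)
      (GenComplex.Complexification g) (GenComplex.nilIndex g)) = ⊥ := by
    rw [GenComplex.lowerCentralSeries_complexification, GenComplex.lowerCentralSeries_nilIndex,
      LieSubmodule.baseChange_bot]
  have hem : GenComplex.supLcs S.projection (GenComplex.nilIndex g) = S.projection := by
    rw [GenComplex.supLcs, hbot, LieSubmodule.bot_toSubmodule, sup_bot_eq]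
  have hem' : Module.finrank ℂ (GenComplex.supLcs S.projection (GenComplex.nilIndex g)) =
      Module.finrank ℂ S.projection := by rw [hem]
  have htype := S.type_add_finrank_projection
  have key := GenComplex.le_dim_of_filtration (N := 2 * n) (m := GenComplex.nilIndex g)
    (e := fun i => Module.finrank ℂ (GenComplex.supLcs S.projection i))
    (d := fun i => Module.finrank ℂ (LieModule.lowerCentralSeries ℂ (GenComplex.Complexification g)
      (GenComplex.Complexification g) i).toSubmodule) hj
    (by simp [hbot])
    (fun i hi him => by
      simp only [GenComplex.finrank_lowerCentralSeries_complexification]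
      rw [GenComplex.finrank_lowerCentralSeries_eq_add_lcsStep, hV i hi him])
    (fun i => hM ▸ Submodule.finrank_le _)
    (fun i => Submodule.finrank_mono (GenComplex.supLcs_antitone _ i.le_succ))
    (GenComplex.finrank_supLcs_add_le _)
    (fun i => hM ▸ GenComplex.finrank_add_finrank_le_of_conj (GenComplex.conjTensor g) le_sup_right
      (fun x hx => by
        rw [GenComplex.conjTensor_symm_apply]
        exact GenComplex.conjTensor_mem_lowerCentralSeries hx)
      (fun x => by
        obtain ⟨a, ha, b, hb, h⟩ := hG x
        exact ⟨a, Submodule.mem_sup_left ha, b, Submodule.mem_sup_left hb, h⟩))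
    (fun i hi h => by
      have htop := GenComplex.supLcs_succ_eq_top hE hi
        (Submodule.eq_top_of_finrank_eq (h.trans hM.symm))
      exact (congrArg (fun F : Submodule ℂ _ => Module.finrank ℂ F) htop).trans
        ((finrank_top ℂ _).trans hM))
    (fun i hd h => congrArg (fun F : Submodule ℂ _ => Module.finrank ℂ F)
      (GenComplex.supLcs_succ_eq_of_eq hE (GenComplex.conjTensor g)
        GenComplex.conjTensor_conjTensor GenComplex.conjTensor_lie
        (fun _ _ => GenComplex.conjTensor_mem_lowerCentralSeries) hG hd
        (Submodule.eq_of_le_of_finrank_eq (GenComplex.supLcs_antitone _ i.le_succ) h.symm).symm))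
    (by simp only [hem']; omega)
  simp only [hem'] at key
  exact ⟨fun h => by have := key.1 h; omega, fun h => by have := key.2 h; omega⟩
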